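/- Let $n$ agents and an opinion alphabet $[M]=\{1,\dots,M\}$ be given, and work on a probability space $(\Omega,\mathbb{P})$. Agent $i$ holds an opinion $X_i\in[M]$ (possibly random); $\mathbf{e}_m\in\mathbb{R}^M$ is the $m$-th unit row vector and $\Pi=\frac1n\sum_{i=1}^n \mathbf{e}_{X_i}$ is the empirical histogram. For $t=0,1,2,\dots$ let $\mathcal{G}(t)$ be a (possibly random) undirected simple graph on $[n]$ with neighbourhoods $\mathcal{N}_i(t)$; let $W(t)$ be a random $n\times n$ matrix with nonnegative entries and $W_{ij}(t)=0$ unless $i,j$ are adjacent in $\mathcal{G}(t)$; let $A(t),B(t)$ be random diagonal $n\times n$ matrices; and let $\delta(t)$ be deterministic step sizes. The estimates are the rows $Q_i(t)$ of the $n\times M$ matrix $\mathbf{Q}(t)$, with $Q_i(0)=\mathbf{e}_{X_i}$ and $$\mathbf{Q}(t+1)=(I-\delta(t)A(t))\mathbf{Q}(t)-\delta(t)B(t)\mathbf{Y}(t)+\delta(t)W(t)\mathbf{Y}(t).$$ Here the rows $Y_i(t)$ of $\mathbf{Y}(t)$ (the messages) lie in $\{\mathbf{0},\mathbf{e}_1,\dots,\mathbf{e}_M\}$.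 Let $\mathcal{F}_t$ be the $\sigma$-algebra generated by $\mathbf{Q}(s)$, $s\le t$, and $\mathcal{G}(s)$, $s<t$. The messages satisfy $\mathbb{P}(Y_i(t)=\mathbf{e}_m\mid\mathcal{F}_t)=P_{i,m}(t)$, where the $i$-th row $P_i(t)$ of $\mathbf{P}(t)$ is a measurable function (which may depend on $i$ and $t$) of $Q_i(t)$. Write $\bar A(t)=\mathbb{E}[A(t)\mid\mathcal{F}_t]$, $\bar B(t)=\mathbb{E}[B(t)\mid\mathcal{F}_t]$, $\bar W(t)=\mathbb{E}[W(t)\mid\mathcal{F}_t]$, $\bar H(t)=\bar W(t)-\bar B(t)-\bar A(t)$ and $$\mathbf{C}(t)=(W(t)-B(t))(\mathbf{P}(t)-\mathbf{Q}(t))+(W(t)-B(t)-\bar W(t)+\bar B(t))\mathbf{Y}(t).$$ Suppose that the entries of $W(t),A(t),B(t)$ are bounded in absolute value, almost surely, by a constant that does not depend on $t$, and that the following conditions hold. 1. (Mixing coefficients) Almost surely $\sum_{j\in\mathcal{N}_i(t)}W_{ij}(t)-A_{ii}(t)-B_{ii}(t)=0$ for all $t>0$ and all $i$. 2. (Decreasing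 step size) $\delta(t)\ge0$, $\delta(t)\to0$, $\sum_{t\ge1}\delta(t)=\infty$ and $\sum_{t\ge1}\delta(t)^2<\infty$. 3. (Limiting dynamics) There is a fixed symmetric matrix $\bar H$ such that almost surely $\bar H_{ij}(t)-\bar H_{ij}=O(\delta(t))$ as $t\to\infty$ for all $i,j$; every eigenvalue $\lambda$ of $\bar H$ satisfies $|\lambda|<1$; $\bar H\mathbf{1}=\mathbf{0}$; and the kernel of $\bar H$ is spanned by $\mathbf{1}$. 4. (Bounded perturbation) Almost surely $\|\mathbb{E}[\mathbf{C}(t)\mid\mathcal{F}_t]\|=O(\delta(t))$ as $t\to\infty$ (Frobenius norm). 5. (Mean preservation) Almost surely $\frac1n\mathbf{1}^{\top}\mathbf{Q}(t)=\Pi$ for all $t$. Then $\mathbf{Q}(t)\to\mathbf{1}\Pi$ almost surely, that is, almost surely $Q_i(t)\to\Pi$ for every agent $i$. -/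

import Mathlib

open MeasureTheory Filter Asymptotics
open scoped Topology Matrix

noncomputable section

/-- The message alphabet `{0, e₁, …, e_M}`; the message `0` means that the node stays silent. -/
def messageSet (M : ℕ) : Set (Fin M → ℝ) :=
  {0} ∪ Set.range (fun m : Fin M => (Pi.single m 1 : Fin M → ℝ))

/-- The `σ`-algebra of the history at time `t`: it is generated by the estimates `Q(s)`, `s ≤ t`,
and by the communication graphs `G(s)`, `s < t`. -/
@[reducible] def historySigma {Ω : Type*} {n M : ℕ} (Q : ℕ → Ω → Matrix (Fin n) (Fin M) ℝ)
    (G : ℕ → Ω → SimpleGraph (Fin n)) (t : ℕ) : MeasurableSpace Ω :=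
  (⨆ s : ℕ, ⨆ _ : s ≤ t, ⨆ i : Fin n, ⨆ m : Fin M,
      MeasurableSpace.comap (fun ω => Q s ω i m) (borel ℝ)) ⊔
    MeasurableSpace.generateFrom
      {E | ∃ s < t, ∃ i j : Fin n, E = {ω | (G s ω).Adj i j}}

/-- The entrywise conditional expectation of a random matrix. -/
def condExpMatrix {Ω : Type*} [MeasurableSpace Ω] {k l : ℕ} (μ : Measure Ω)
    (F : MeasurableSpace Ω) (Z : Ω → Matrix (Fin k) (Fin l) ℝ) :
    Ω → Matrix (Fin k) (Fin l) ℝ :=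
  fun ω => Matrix.of fun i j => (μ[fun ω' => Z ω' i j | F]) ω

/-- The Frobenius norm. -/
def frobeniusNorm {k l : ℕ} (Z : Matrix (Fin k) (Fin l) ℝ) : ℝ :=
  Real.sqrt (∑ i, ∑ j, Z i j ^ 2)

/-- A social sampling protocol with linear updates: `n` agents, opinions in `Fin M`, on a
probability space `(Ω, μ)`. The matrices `A(t)` and `B(t)` of the protocol are diagonal and are
given by their diagonals `a t ω` and `b t ω`. -/
structure SocialSampling (n M : ℕ) {Ω : Type*} [MeasurableSpace Ω] (μ : Measure Ω) where
  /-- initial opinions -/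
  X : Fin n → Ω → Fin M
  /-- communication graphs (undirected, possibly random) -/
  G : ℕ → Ω → SimpleGraph (Fin n)
  /-- step sizes -/
  δ : ℕ → ℝ
  /-- weights given to the messages of the neighbours -/
  W : ℕ → Ω → Matrix (Fin n) (Fin n) ℝ
  /-- diagonal of `A(t)` -/
  a : ℕ → Ω → Fin n → ℝ
  /-- diagonal of `B(t)` -/
  b : ℕ → Ω → Fin n → ℝ
  /-- the rule by which node `i` at time `t` turns its estimate into a sampling distribution -/
  rule : ℕ → Fin n → (Fin M → ℝ) → (Fin M → ℝ)
  /-- messages; row `i` is the message of node `i` -/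
  Y : ℕ → Ω → Matrix (Fin n) (Fin M) ℝ
  /-- estimates; row `i` is the estimate of node `i` -/
  Q : ℕ → Ω → Matrix (Fin n) (Fin M) ℝ
  measurable_X : ∀ i, Measurable (X i)
  measurableSet_G : ∀ t i j, MeasurableSet {ω | (G t ω).Adj i j}
  measurable_W : ∀ t i j, Measurable fun ω => W t ω i j
  measurable_a : ∀ t i, Measurable fun ω => a t ω i
  measurable_b : ∀ t i, Measurable fun ω => b t ω i
  measurable_rule : ∀ t i, Measurable (rule t i)
  measurable_Y : ∀ t i m, Measurable fun ω => Y t ω i m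
  W_nonneg : ∀ t ω i j, 0 ≤ W t ω i j
  W_support : ∀ t ω i j, ¬ (G t ω).Adj i j → W t ω i j = 0
  Y_mem : ∀ t ω i, Y t ω i ∈ messageSet M
  /-- Given the history, node `i` sends `e_m` with probability `P_{i,m}(t)`, where
  `P_i(t) = rule t i (Q_i(t))`; with the remaining probability it is silent. (In particular
  `P_i(t)` is almost surely nonnegative with sum at most one.) -/
  sampling : ∀ t i m,
    μ[Set.indicator {ω | Y t ω i = Pi.single m 1} (fun _ => (1 : ℝ)) | historySigma Q G t]
      =ᵐ[μ] fun ω => rule t i (Q t ω i) m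
  init : ∀ ω i, Q 0 ω i = Pi.single (X i ω) 1
  update : ∀ t ω, Q (t + 1) ω =
    (1 - δ t • Matrix.diagonal (a t ω)) * Q t ω
      - δ t • (Matrix.diagonal (b t ω) * Y t ω) + δ t • (W t ω * Y t ω)

namespace SocialSampling

variable {n M : ℕ} {Ω : Type*} [MeasurableSpace Ω] {μ : Measure Ω}

/-- The empirical distribution of the initial opinions. -/
def empirical (S : SocialSampling n M μ) (ω : Ω) : Fin M → ℝ :=
  fun m => (1 / (n : ℝ)) * ∑ i, if S.X i ω = m then 1 else 0

/-- `F_t`. -/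
@[reducible] def F (S : SocialSampling n M μ) (t : ℕ) : MeasurableSpace Ω := historySigma S.Q S.G t

/-- `A(t)`. -/
def A (S : SocialSampling n M μ) (t : ℕ) (ω : Ω) : Matrix (Fin n) (Fin n) ℝ :=
  Matrix.diagonal (S.a t ω)

/-- `B(t)`. -/
def B (S : SocialSampling n M μ) (t : ℕ) (ω : Ω) : Matrix (Fin n) (Fin n) ℝ :=
  Matrix.diagonal (S.b t ω)

/-- `P(t)`: row `i` is the sampling distribution of node `i` on `e_1, …, e_M`. -/
def P (S : SocialSampling n M μ) (t : ℕ) (ω : Ω) : Matrix (Fin n) (Fin M) ℝ :=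
  Matrix.of fun i => S.rule t i (S.Q t ω i)

/-- `Ā(t) = E[A(t) | F_t]`. -/
def Abar (S : SocialSampling n M μ) (t : ℕ) : Ω → Matrix (Fin n) (Fin n) ℝ :=
  condExpMatrix μ (S.F t) (S.A t)

/-- `B̄(t) = E[B(t) | F_t]`. -/
def Bbar (S : SocialSampling n M μ) (t : ℕ) : Ω → Matrix (Fin n) (Fin n) ℝ :=
  condExpMatrix μ (S.F t) (S.B t)

/-- `W̄(t) = E[W(t) | F_t]`. -/
def Wbar (S : SocialSampling n M μ) (t : ℕ) : Ω → Matrix (Fin n) (Fin n) ℝ :=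
  condExpMatrix μ (S.F t) (S.W t)

/-- `H̄(t) = W̄(t) - B̄(t) - Ā(t)`. -/
def Hbar (S : SocialSampling n M μ) (t : ℕ) (ω : Ω) : Matrix (Fin n) (Fin n) ℝ :=
  S.Wbar t ω - S.Bbar t ω - S.Abar t ω

/-- The correction term `C(t)`. -/
def C (S : SocialSampling n M μ) (t : ℕ) (ω : Ω) : Matrix (Fin n) (Fin M) ℝ :=
  (S.W t ω - S.B t ω) * (S.P t ω - S.Q t ω)
    + (S.W t ω - S.B t ω - S.Wbar t ω + S.Bbar t ω) * S.Y t ω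

/-- The coefficients `W(t)`, `A(t)`, `B(t)` are uniformly bounded. -/
def BoundedCoefficients (S : SocialSampling n M μ) : Prop :=
  ∃ K : ℝ, ∀ t, ∀ᵐ ω ∂μ,
    (∀ i j, |S.W t ω i j| ≤ K) ∧ ∀ i, |S.a t ω i| ≤ K ∧ |S.b t ω i| ≤ K

open Classical in
/-- Mixing coefficients: `∑_{j ∈ N_i(t)} W_ij(t) - A_ii(t) - B_ii(t) = 0` for `t > 0`. -/
def MixingCoefficients (S : SocialSampling n M μ) : Prop :=
  ∀ t, 0 < t → ∀ᵐ ω ∂μ, ∀ i,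
    (∑ j with (S.G t ω).Adj i j, S.W t ω i j) - S.A t ω i i - S.B t ω i i = 0

/-- Decreasing step size. -/
def DecreasingStepSize (S : SocialSampling n M μ) : Prop :=
  (∀ t, 0 ≤ S.δ t) ∧ Tendsto S.δ atTop (𝓝 0) ∧
    Tendsto (fun T => ∑ t ∈ Finset.Icc 1 T, S.δ t) atTop atTop ∧
    Summable fun t => S.δ (t + 1) ^ 2

/-- Limiting dynamics: `H̄(t) = H + O(δ(t))` almost surely, for a fixed symmetric matrix `H` all
of whose eigenvalues have modulus less than `1`, with `H 1 = 0` and with no null vectors other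
than the multiples of `1`. -/
def LimitingDynamics (S : SocialSampling n M μ) : Prop :=
  ∃ H : Matrix (Fin n) (Fin n) ℝ, H.IsSymm ∧
    (∀ i j, ∀ᵐ ω ∂μ, (fun t => S.Hbar t ω i j - H i j) =O[atTop] S.δ) ∧
    (∀ r : ℝ, Module.End.HasEigenvalue (Matrix.toLin' H) r → |r| < 1) ∧
    H *ᵥ (fun _ => 1) = 0 ∧
    ∀ v : Fin n → ℝ, H *ᵥ v = 0 → ∃ c : ℝ, v = fun _ => c

/-- Bounded perturbation: `‖E[C(t) | F_t]‖ = O(δ(t))` almost surely. -/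
def BoundedPerturbation (S : SocialSampling n M μ) : Prop :=
  ∀ᵐ ω ∂μ, (fun t => frobeniusNorm (condExpMatrix μ (S.F t) (S.C t) ω)) =O[atTop] S.δ

/-- Mean preservation: the average of the node estimates is the empirical distribution. -/
def MeanPreservation (S : SocialSampling n M μ) : Prop :=
  ∀ t, ∀ᵐ ω ∂μ, ∀ m, (1 / (n : ℝ)) * ∑ i, S.Q t ω i m = S.empirical ω m

end SocialSampling

end

/-! For a fixed opinion let `q` be its column of `Q(t)` and `z` the deviation of `q` from consensus.
One step adds `δ(t) D(t)` to `q`, and the conditional mean of `D(t)` given `F_t` is `H̄(t) q` plus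
the column of `E[C(t) | F_t]`. With `H` the limit of `H̄(t)`, this is `H q = H z` up to an error of
order `δ(t) (1 + ‖z‖)`.

The off-diagonal entries of `H` are limits of conditional means of the `W_ij(t) ≥ 0`, so they are
nonnegative. As the rows and columns of `H` sum to `0`, `xᵀ H x = -½ ∑ H_ij (x_i - x_j)²`, which is
negative for nonzero `x` of mean `0` because only constants are annihilated by `H`. Mean
preservation keeps `z` among these vectors, on which therefore `xᵀ H x ≤ -r ‖x‖²` for some `r > 0`,
and Robbins and Siegmund's convergence theorem applies to `‖z‖²`. -/

section AlmostSupermartingale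

variable {Ω : Type*} {m0 : MeasurableSpace Ω} {μ : Measure Ω} {ℱ : Filtration ℕ m0}
  {V α β γ : ℕ → Ω → ℝ}

theorem exists_ae_tendsto_of_supermartingale_of_nonneg [IsFiniteMeasure μ] {U : ℕ → Ω → ℝ}
    (hU : Supermartingale U ℱ μ) (hU0 : ∀ t, 0 ≤ᵐ[μ] U t) :
    ∀ᵐ ω ∂μ, ∃ c, Tendsto (fun t => U t ω) atTop (𝓝 c) := by
  have hbdd : ∀ t, eLpNorm ((-U) t) 1 μ ≤ ((∫ ω, U 0 ω ∂μ).toNNReal : ENNReal) := fun t => by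
    rw [Pi.neg_apply, eLpNorm_neg, eLpNorm_one_eq_lintegral_enorm,
      ← ofReal_integral_norm_eq_lintegral_enorm (hU.integrable t)]
    refine ENNReal.ofReal_le_ofReal ?_
    calc ∫ ω, ‖U t ω‖ ∂μ = ∫ ω, U t ω ∂μ :=
          integral_congr_ae ((hU0 t).mono fun ω hω => Real.norm_of_nonneg hω)
      _ ≤ ∫ ω, U 0 ω ∂μ := by
          simpa only [Measure.restrict_univ] using hU.setIntegral_le (Nat.zero_le t) .univ
  filter_upwards [hU.neg.exists_ae_tendsto_of_bdd hbdd] with ω ⟨c, hc⟩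
  exact ⟨-c, by simpa only [Pi.neg_apply, neg_neg] using hc.neg⟩

/-- Robbins and Siegmund's nonnegative almost supermartingales: up to the multiplicative
perturbation `α` and the additive perturbation `β`, the process `V` decreases on average by `γ`. -/
structure IsAlmostSupermartingale (ℱ : Filtration ℕ m0) (μ : Measure Ω) (V α β γ : ℕ → Ω → ℝ) :
    Prop where
  stronglyAdapted : StronglyAdapted ℱ V
  stronglyAdapted_alpha : StronglyAdapted ℱ α
  stronglyAdapted_beta : StronglyAdapted ℱ β
  stronglyAdapted_gamma : StronglyAdapted ℱ γ
  integrable : ∀ t, Integrable (V t) μ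
  nonneg : ∀ t ω, 0 ≤ V t ω
  alpha_nonneg : ∀ t ω, 0 ≤ α t ω
  beta_nonneg : ∀ t ω, 0 ≤ β t ω
  gamma_nonneg : ∀ t ω, 0 ≤ γ t ω
  condExp_le : ∀ t, ∀ᵐ ω ∂μ,
    (μ[V (t + 1) | ℱ t]) ω ≤ (1 + α t ω) * V t ω + β t ω - γ t ω

/-- The product `∏_{s < t} (1 + α_s)⁻¹`, by which an almost supermartingale with multiplicative
perturbation `α` has to be discounted to become a supermartingale. -/
noncomputable def discount (α : ℕ → Ω → ℝ) (t : ℕ) (ω : Ω) : ℝ :=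
  ∏ s ∈ Finset.range t, (1 + α s ω)⁻¹

theorem discount_pos (hα : ∀ t ω, 0 ≤ α t ω) (t : ℕ) (ω : Ω) : 0 < discount α t ω :=
  Finset.prod_pos fun s _ => inv_pos.2 (by linarith [hα s ω])

theorem discount_le_one (hα : ∀ t ω, 0 ≤ α t ω) (t : ℕ) (ω : Ω) : discount α t ω ≤ 1 :=
  Finset.prod_le_one (fun s _ => inv_nonneg.2 (by linarith [hα s ω]))
    fun s _ => inv_le_one_of_one_le₀ (by linarith [hα s ω])

theorem discount_succ_mul (hα : ∀ t ω, 0 ≤ α t ω) (t : ℕ) (ω : Ω) :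
    discount α (t + 1) ω * (1 + α t ω) = discount α t ω := by
  have hne : 1 + α t ω ≠ 0 := by linarith [hα t ω]
  rw [discount, Finset.prod_range_succ, inv_mul_cancel_right₀ hne, discount]

theorem stronglyMeasurable_discount (hα : StronglyAdapted ℱ α) {t u : ℕ} (htu : t ≤ u + 1) :
    StronglyMeasurable[ℱ u] (discount α t) := by
  refine Finset.stronglyMeasurable_fun_prod _ fun s hs => ?_
  have hsu : s ≤ u := by have := Finset.mem_range.1 hs; omega
  exact (stronglyMeasurable_const.add ((hα s).mono (ℱ.mono hsu))).measurable.inv.stronglyMeasurable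

theorem integrable_discount_mul (hα : StronglyAdapted ℱ α) (hα0 : ∀ t ω, 0 ≤ α t ω) (t : ℕ)
    {f : Ω → ℝ} (hf : Integrable f μ) : Integrable (discount α t * f) μ :=
  hf.bdd_mul ((stronglyMeasurable_discount hα t.le_succ).mono (ℱ.le t)).aestronglyMeasurable
    (c := 1) (ae_of_all _ fun ω => by
      rw [Real.norm_of_nonneg (discount_pos hα0 t ω).le]
      exact discount_le_one hα0 t ω)

theorem exists_tendsto_inv_discount {ω : Ω} (hsum : Summable fun t => α t ω) :
    ∃ p, Tendsto (fun t => (discount α t ω)⁻¹) atTop (𝓝 p) :=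
  ⟨_, (Real.multipliable_one_add_of_summable hsum).hasProd.tendsto_prod_nat.congr fun t => by
    rw [discount, Finset.prod_inv_distrib, inv_inv]⟩

namespace IsAlmostSupermartingale

theorem condExp_discount_le (h : IsAlmostSupermartingale ℱ μ V α 0 γ) (t : ℕ) :
    ∀ᵐ ω ∂μ, (μ[discount α (t + 1) * V (t + 1) | ℱ t]) ω ≤
      discount α t ω * V t ω - discount α (t + 1) ω * γ t ω := by
  have hpull := condExp_mul_of_stronglyMeasurable_left
    (stronglyMeasurable_discount h.stronglyAdapted_alpha le_rfl)
    (integrable_discount_mul h.stronglyAdapted_alpha h.alpha_nonneg (t + 1) (h.integrable (t + 1)))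
    (h.integrable (t + 1))
  filter_upwards [hpull, h.condExp_le t] with ω hpull hle
  calc (μ[discount α (t + 1) * V (t + 1) | ℱ t]) ω
      = discount α (t + 1) ω * (μ[V (t + 1) | ℱ t]) ω := hpull
    _ ≤ discount α (t + 1) ω * ((1 + α t ω) * V t ω + (0 : ℕ → Ω → ℝ) t ω - γ t ω) :=
        mul_le_mul_of_nonneg_left hle (discount_pos h.alpha_nonneg _ ω).le
    _ = discount α t ω * V t ω - discount α (t + 1) ω * γ t ω := by
        rw [← discount_succ_mul h.alpha_nonneg t, Pi.zero_apply, Pi.zero_apply]; ring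

theorem integrable_discount_mul_gamma (h : IsAlmostSupermartingale ℱ μ V α 0 γ) (t : ℕ) :
    Integrable (discount α (t + 1) * γ t) μ := by
  have hmeas : StronglyMeasurable[ℱ t] (discount α (t + 1) * γ t) :=
    (stronglyMeasurable_discount h.stronglyAdapted_alpha le_rfl).mul (h.stronglyAdapted_gamma t)
  refine Integrable.mono'
    ((integrable_discount_mul h.stronglyAdapted_alpha h.alpha_nonneg t (h.integrable t)).sub
      (integrable_condExp (m := ℱ t) (f := discount α (t + 1) * V (t + 1))))
    (hmeas.mono (ℱ.le t)).aestronglyMeasurable ?_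
  filter_upwards [h.condExp_discount_le t] with ω hω
  have hpos : 0 ≤ discount α (t + 1) ω * γ t ω :=
    mul_nonneg (discount_pos h.alpha_nonneg _ ω).le (h.gamma_nonneg t ω)
  rw [Pi.mul_apply, Real.norm_of_nonneg hpos, Pi.sub_apply, Pi.mul_apply]
  linarith

theorem supermartingale_discount (h : IsAlmostSupermartingale ℱ μ V α 0 γ) [IsFiniteMeasure μ] :
    Supermartingale
      (fun t => discount α t * V t + ∑ s ∈ Finset.range t, discount α (s + 1) * γ s) ℱ μ := by
  have hmeas : ∀ {t u}, t ≤ u + 1 →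
      StronglyMeasurable[ℱ u] (∑ s ∈ Finset.range t, discount α (s + 1) * γ s) := fun htu =>
    Finset.stronglyMeasurable_sum _ fun s hs =>
      have hsu := Nat.lt_succ_iff.1 ((Finset.mem_range.1 hs).trans_le htu)
      ((stronglyMeasurable_discount h.stronglyAdapted_alpha le_rfl).mul
        (h.stronglyAdapted_gamma s)).mono (ℱ.mono hsu)
  have hV : ∀ t, Integrable (discount α t * V t) μ := fun t =>
    integrable_discount_mul h.stronglyAdapted_alpha h.alpha_nonneg t (h.integrable t)
  have hγ : ∀ t, Integrable (∑ s ∈ Finset.range t, discount α (s + 1) * γ s) μ := fun t =>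
    integrable_finsetSum' _ fun s _ => h.integrable_discount_mul_gamma s
  refine supermartingale_nat (fun t => ((stronglyMeasurable_discount h.stronglyAdapted_alpha
    t.le_succ).mul (h.stronglyAdapted t)).add (hmeas t.le_succ)) (fun t => (hV t).add (hγ t))
    fun t => ?_
  filter_upwards [condExp_add (hV (t + 1)) (hγ (t + 1)) (ℱ t), h.condExp_discount_le t]
    with ω hadd hle
  rw [hadd, Pi.add_apply,
    condExp_of_stronglyMeasurable (ℱ.le t) (hmeas le_rfl) (hγ (t + 1)), Finset.sum_range_succ]
  simp only [Pi.add_apply, Pi.mul_apply]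
  linarith

theorem ae_tendsto_and_summable_of_add_eq_zero [IsFiniteMeasure μ]
    (h : IsAlmostSupermartingale ℱ μ V α 0 γ) :
    ∀ᵐ ω ∂μ, Summable (fun t => α t ω) →
      (∃ l, Tendsto (fun t => V t ω) atTop (𝓝 l)) ∧ Summable fun t => γ t ω := by
  have hd := discount_pos h.alpha_nonneg
  have hterm : ∀ s ω, 0 ≤ discount α (s + 1) ω * γ s ω := fun s ω =>
    mul_nonneg (hd _ ω).le (h.gamma_nonneg s ω)
  have hU : ∀ t ω, 0 ≤ discount α t ω * V t ω := fun t ω =>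
    mul_nonneg (hd t ω).le (h.nonneg t ω)
  have hconv := exists_ae_tendsto_of_supermartingale_of_nonneg h.supermartingale_discount
    fun t => ae_of_all _ fun ω => by
      simpa using add_nonneg (hU t ω) (Finset.sum_nonneg fun s _ => hterm s ω)
  filter_upwards [hconv] with ω ⟨c, hc⟩ hα
  simp only [Pi.add_apply, Pi.mul_apply, Finset.sum_apply] at hc
  obtain ⟨p, hp⟩ := exists_tendsto_inv_discount hα
  obtain ⟨R, hR⟩ := hc.bddAbove_range
  have hsum : Summable fun s => discount α (s + 1) ω * γ s ω :=
    summable_of_sum_range_le (c := R) (fun s => hterm s ω) fun t => by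
      linarith [hU t ω, Set.forall_mem_range.1 hR t]
  refine ⟨⟨_, ((hc.sub hsum.hasSum.tendsto_sum_nat).mul hp).congr fun t => ?_⟩, ?_⟩
  · rw [add_sub_cancel_right, mul_right_comm, mul_inv_cancel₀ (hd t ω).ne', one_mul]
  · refine summable_of_isBigO_nat hsum ?_
    refine (((hp.comp (tendsto_add_atTop_nat 1)).isBigO_one ℝ).mul (isBigO_refl _ _)).congr
      (fun t => ?_) fun t => one_mul _
    exact inv_mul_cancel_left₀ (hd (t + 1) ω).ne' _

theorem add_one (h : IsAlmostSupermartingale ℱ μ V α β γ) [IsFiniteMeasure μ] :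
    IsAlmostSupermartingale ℱ μ (V + 1) (α + β) 0 γ where
  stronglyAdapted t := (h.stronglyAdapted t).add stronglyMeasurable_const
  stronglyAdapted_alpha t := (h.stronglyAdapted_alpha t).add (h.stronglyAdapted_beta t)
  stronglyAdapted_beta _ := stronglyMeasurable_const
  stronglyAdapted_gamma := h.stronglyAdapted_gamma
  integrable t := (h.integrable t).add (integrable_const 1)
  nonneg t ω := add_nonneg (h.nonneg t ω) zero_le_one
  alpha_nonneg t ω := add_nonneg (h.alpha_nonneg t ω) (h.beta_nonneg t ω)
  beta_nonneg _ _ := le_rfl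
  gamma_nonneg := h.gamma_nonneg
  condExp_le t := by
    have hadd : μ[V (t + 1) + 1 | ℱ t] =ᵐ[μ] μ[V (t + 1) | ℱ t] + μ[(1 : Ω → ℝ) | ℱ t] :=
      condExp_add (h.integrable (t + 1)) (integrable_const 1) (ℱ t)
    have hone : μ[(1 : Ω → ℝ) | ℱ t] = 1 := condExp_const (ℱ.le t) (1 : ℝ)
    filter_upwards [hadd, h.condExp_le t] with ω hadd hle
    have hα := h.alpha_nonneg t ω
    have hβV := mul_nonneg (h.beta_nonneg t ω) (h.nonneg t ω)
    simp only [Pi.add_apply, Pi.one_apply, Pi.zero_apply, hone] at hadd ⊢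
    linarith

theorem ae_tendsto_and_summable [IsFiniteMeasure μ] (h : IsAlmostSupermartingale ℱ μ V α β γ) :
    ∀ᵐ ω ∂μ, Summable (fun t => α t ω) → Summable (fun t => β t ω) →
      (∃ l, Tendsto (fun t => V t ω) atTop (𝓝 l)) ∧ Summable fun t => γ t ω := by
  filter_upwards [h.add_one.ae_tendsto_and_summable_of_add_eq_zero] with ω hω hα hβ
  obtain ⟨⟨l, hl⟩, hγ⟩ := hω (hα.add hβ)
  exact ⟨⟨l - 1, by simpa using hl.sub_const 1⟩, hγ⟩

end IsAlmostSupermartingale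

end AlmostSupermartingale

theorem tendsto_zero_of_summable_mul {δ v : ℕ → ℝ} (hδ : ∀ t, 0 ≤ δ t) (hv : ∀ t, 0 ≤ v t)
    (hdiv : ¬ Summable δ) (hsum : Summable fun t => δ t * v t) {l : ℝ}
    (hl : Tendsto v atTop (𝓝 l)) : Tendsto v atTop (𝓝 0) := by
  rcases (ge_of_tendsto' hl hv).eq_or_lt with rfl | hpos
  · exact hl
  refine absurd (summable_of_isBigO_nat hsum (IsBigO.of_bound (2 / l) ?_)) hdiv
  filter_upwards [hl.eventually (lt_mem_nhds (half_lt_self hpos))] with t ht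
  rw [Real.norm_of_nonneg (hδ t), Real.norm_of_nonneg (mul_nonneg (hδ t) (hv t))]
  calc δ t = 2 / l * (δ t * (l / 2)) := by field_simp
    _ ≤ 2 / l * (δ t * v t) := by have := hδ t; gcongr

section StochasticApproximation

variable {Ω E : Type*} {m0 : MeasurableSpace Ω} {μ : Measure Ω} [NormedAddCommGroup E]
  [InnerProductSpace ℝ E]

theorem integrable_inner_of_memLp_two {f g : Ω → E} (hf : MemLp f 2 μ) (hg : MemLp g 2 μ) :
    Integrable (fun ω => inner ℝ (f ω) (g ω)) μ :=
  (hf.norm.integrable_mul hg.norm).mono' (hf.1.inner hg.1)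
    (ae_of_all _ fun _ => norm_inner_le_norm _ _)

theorem norm_add_smul_sq_le {z d : E} {s K : ℝ} (hd : ‖d‖ ≤ K * (1 + ‖z‖)) :
    ‖z + s • d‖ ^ 2 ≤
      (1 + 2 * s ^ 2 * K ^ 2) * ‖z‖ ^ 2 + 2 * s ^ 2 * K ^ 2 + 2 * s * inner ℝ z d := by
  have hd2 : ‖d‖ ^ 2 ≤ 2 * K ^ 2 * (1 + ‖z‖ ^ 2) := calc
    ‖d‖ ^ 2 ≤ (K * (1 + ‖z‖)) ^ 2 := by gcongr
    _ ≤ 2 * K ^ 2 * (1 + ‖z‖ ^ 2) := by nlinarith [sq_nonneg (K * (1 - ‖z‖))]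
  rw [norm_add_sq_real, norm_smul, inner_smul_right, mul_pow, Real.norm_eq_abs, sq_abs]
  nlinarith [mul_le_mul_of_nonneg_left hd2 (sq_nonneg s)]

theorem inner_apply_add_le {z q c : E} {T T' : E →L[ℝ] E} {r b e f : ℝ}
    (hT : inner ℝ z (T z) ≤ -r * ‖z‖ ^ 2) (hTq : T q = T z) (hb : 0 ≤ b) (hq : ‖q‖ ≤ ‖z‖ + b)
    (he : ‖T' - T‖ ≤ e) (hf : ‖c‖ ≤ f) :
    inner ℝ z (T' q + c) ≤ -r * ‖z‖ ^ 2 + ((1 + b) * e + f) * (1 + ‖z‖ ^ 2) := by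
  have he0 : 0 ≤ e := (norm_nonneg _).trans he
  have hle_one_add_sq : ‖z‖ ≤ 1 + ‖z‖ ^ 2 := by nlinarith [sq_nonneg (‖z‖ - 1)]
  have hdiff : inner ℝ z ((T' - T) q) ≤ (1 + b) * e * (1 + ‖z‖ ^ 2) := calc
    inner ℝ z ((T' - T) q) ≤ ‖z‖ * ‖(T' - T) q‖ := real_inner_le_norm _ _
    _ ≤ ‖z‖ * (e * (‖z‖ + b)) := by
      gcongr
      exact (T' - T).le_of_opNorm_le_of_le he hq
    _ = e * (‖z‖ ^ 2 + b * ‖z‖) := by ring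
    _ ≤ e * ((1 + ‖z‖ ^ 2) + b * (1 + ‖z‖ ^ 2)) := by gcongr; linarith
    _ = (1 + b) * e * (1 + ‖z‖ ^ 2) := by ring
  have hc : inner ℝ z c ≤ f * (1 + ‖z‖ ^ 2) := calc
    inner ℝ z c ≤ ‖z‖ * ‖c‖ := real_inner_le_norm _ _
    _ ≤ (1 + ‖z‖ ^ 2) * f := by gcongr
    _ = f * (1 + ‖z‖ ^ 2) := mul_comm _ _
  have hsplit : T' q + c = (T' - T) q + T z + c := by
    rw [sub_apply, hTq, sub_add_cancel]
  rw [hsplit, inner_add_right, inner_add_right]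
  linarith

theorem summable_perturbation {δ ε : ℕ → ℝ} (hδ2 : Summable fun t => δ t ^ 2)
    (hε : ε =O[atTop] δ) (K : ℝ) :
    Summable fun t => 2 * δ t * ε t + 2 * δ t ^ 2 * K ^ 2 := by
  refine .add ?_ ((hδ2.mul_left 2).mul_right _)
  refine summable_of_isBigO_nat hδ2 ?_
  simpa only [mul_assoc, sq] using ((isBigO_refl δ atTop).mul hε).const_mul_left 2

variable [IsFiniteMeasure μ] [CompleteSpace E]

theorem condExp_inner_of_stronglyMeasurable_left {m : MeasurableSpace Ω} {f g : Ω → E}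
    (hfm : StronglyMeasurable[m] f) (hf : MemLp f 2 μ) (hg : MemLp g 2 μ) :
    μ[fun ω => inner ℝ (f ω) (g ω) | m] =ᵐ[μ] fun ω => inner ℝ (f ω) ((μ[g | m]) ω) :=
  condExp_bilin_of_stronglyMeasurable_left (innerSL ℝ) hfm (integrable_inner_of_memLp_two hf hg)
    (hg.integrable one_le_two)

theorem condExp_norm_add_smul_sq_le {m : MeasurableSpace Ω} (hm : m ≤ m0) {z d : Ω → E}
    {ε : Ω → ℝ} {s K r : ℝ} (hs : 0 ≤ s) (hzm : StronglyMeasurable[m] z) (hz : MemLp z 2 μ)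
    (hd : MemLp d 2 μ) (hgrowth : ∀ᵐ ω ∂μ, ‖d ω‖ ≤ K * (1 + ‖z ω‖))
    (hdrift : ∀ᵐ ω ∂μ,
      inner ℝ (z ω) ((μ[d | m]) ω) ≤ -r * ‖z ω‖ ^ 2 + ε ω * (1 + ‖z ω‖ ^ 2)) :
    ∀ᵐ ω ∂μ, (μ[fun ω => ‖z ω + s • d ω‖ ^ 2 | m]) ω ≤
      (1 + (2 * s * ε ω + 2 * s ^ 2 * K ^ 2)) * ‖z ω‖ ^ 2
        + (2 * s * ε ω + 2 * s ^ 2 * K ^ 2) - 2 * r * (s * ‖z ω‖ ^ 2) := by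
  let known : Ω → ℝ := fun ω => (1 + 2 * s ^ 2 * K ^ 2) * ‖z ω‖ ^ 2 + 2 * s ^ 2 * K ^ 2
  have hknown : Integrable known μ :=
    ((hz.integrable_norm_pow two_ne_zero).const_mul _).add (integrable_const _)
  have hknown_m : StronglyMeasurable[m] known :=
    ((hzm.norm.pow 2).const_mul _).add stronglyMeasurable_const
  have hinner := integrable_inner_of_memLp_two hz hd
  have hmono : μ[fun ω => ‖z ω + s • d ω‖ ^ 2 | m] ≤ᵐ[μ]
      μ[known + (2 * s) • fun ω => inner ℝ (z ω) (d ω) | m] :=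
    condExp_mono ((hz.add (hd.const_smul s)).integrable_norm_pow two_ne_zero)
      (hknown.add (hinner.smul (2 * s)))
      (hgrowth.mono fun ω hω => norm_add_smul_sq_le hω)
  filter_upwards [hmono, hdrift, condExp_add hknown (hinner.smul (2 * s)) m,
    condExp_smul (2 * s) (fun ω => inner ℝ (z ω) (d ω)) m,
    condExp_inner_of_stronglyMeasurable_left hzm hz hd]
    with ω hmono hdrift hadd hsmul hpull
  rw [hadd, Pi.add_apply, hsmul, Pi.smul_apply, hpull,
    condExp_of_stronglyMeasurable hm hknown_m hknown, smul_eq_mul] at hmono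
  simp only [known] at hmono
  nlinarith [mul_le_mul_of_nonneg_left hdrift (mul_nonneg zero_le_two hs)]

/-- `‖z‖²` is an almost supermartingale decreasing on average by `2 r δ ‖z‖²`; hence
`∑ δ ‖z‖² < ∞`, and as `∑ δ = ∞` the limit of `‖z‖²` can only be `0`. -/
theorem ae_tendsto_zero_of_inner_condExp_le {ℱ : Filtration ℕ m0} {z d : ℕ → Ω → E}
    {ε : ℕ → Ω → ℝ} {δ : ℕ → ℝ} {K r : ℝ} (hr : 0 < r)
    (hδ : ∀ t, 0 ≤ δ t) (hδ1 : ¬ Summable δ) (hδ2 : Summable fun t => δ t ^ 2)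
    (hzm : StronglyAdapted ℱ z) (hz : ∀ t, MemLp (z t) 2 μ) (hd : ∀ t, MemLp (d t) 2 μ)
    (hsucc : ∀ t, z (t + 1) =ᵐ[μ] z t + δ t • d t)
    (hgrowth : ∀ t, ∀ᵐ ω ∂μ, ‖d t ω‖ ≤ K * (1 + ‖z t ω‖))
    (hεm : StronglyAdapted ℱ ε) (hε0 : ∀ t ω, 0 ≤ ε t ω)
    (hε : ∀ᵐ ω ∂μ, (fun t => ε t ω) =O[atTop] δ)
    (hdrift : ∀ t, ∀ᵐ ω ∂μ, inner ℝ (z t ω) ((μ[d t | ℱ t]) ω) ≤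
      -r * ‖z t ω‖ ^ 2 + ε t ω * (1 + ‖z t ω‖ ^ 2)) :
    ∀ᵐ ω ∂μ, Tendsto (fun t => z t ω) atTop (𝓝 0) := by
  let η : ℕ → Ω → ℝ := fun t ω => 2 * δ t * ε t ω + 2 * δ t ^ 2 * K ^ 2
  have hη : StronglyAdapted ℱ η := fun t =>
    ((hεm t).const_mul _).add stronglyMeasurable_const
  have hη0 : ∀ t ω, 0 ≤ η t ω := fun t ω => by have := hδ t; have := hε0 t ω; positivity
  have halmost : IsAlmostSupermartingale ℱ μ (fun t ω => ‖z t ω‖ ^ 2) η η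
      (fun t ω => 2 * r * (δ t * ‖z t ω‖ ^ 2)) :=
    { stronglyAdapted := fun t => (hzm t).norm.pow 2
      stronglyAdapted_alpha := hη
      stronglyAdapted_beta := hη
      stronglyAdapted_gamma := fun t => (((hzm t).norm.pow 2).const_mul _).const_mul _
      integrable := fun t => (hz t).integrable_norm_pow two_ne_zero
      nonneg := fun t ω => sq_nonneg _
      alpha_nonneg := hη0
      beta_nonneg := hη0
      gamma_nonneg := fun t ω => by have := hδ t; positivity
      condExp_le := fun t => by
        have hcongr := condExp_congr_ae (m := ℱ t)
          ((hsucc t).fun_comp fun x => ‖x‖ ^ 2)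
        filter_upwards [hcongr, condExp_norm_add_smul_sq_le (ℱ.le t) (hδ t) (hzm t) (hz t) (hd t)
          (hgrowth t) (hdrift t)] with ω hcongr hle
        exact hcongr.trans_le hle }
  filter_upwards [halmost.ae_tendsto_and_summable, hε] with ω hω hεω
  have hη_sum := summable_perturbation hδ2 hεω K
  obtain ⟨⟨l, hl⟩, hsum⟩ := hω hη_sum hη_sum
  have hsum' : Summable fun t => δ t * ‖z t ω‖ ^ 2 :=
    (summable_mul_left_iff (mul_pos two_pos hr).ne').1 hsum
  have hsq := tendsto_zero_of_summable_mul hδ (fun t => sq_nonneg ‖z t ω‖) hδ1 hsum' hl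
  refine tendsto_zero_iff_norm_tendsto_zero.2 ?_
  simpa only [Real.sqrt_sq (norm_nonneg _), Real.sqrt_zero] using hsq.sqrt

end StochasticApproximation

section QuadraticForm

theorem exists_inner_apply_le_neg_mul_norm_sq {E : Type*} [NormedAddCommGroup E]
    [InnerProductSpace ℝ E] [FiniteDimensional ℝ E] (T : E →L[ℝ] E) (K : Submodule ℝ E)
    (hT : ∀ x ∈ K, x ≠ 0 → inner ℝ x (T x) < 0) :
    ∃ r > 0, ∀ x ∈ K, inner ℝ x (T x) ≤ -r * ‖x‖ ^ 2 := by
  have hcont : ContinuousOn (fun x => inner ℝ x (T x)) (Metric.sphere 0 1 ∩ K) := by fun_prop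
  have hcompact : IsCompact (Metric.sphere (0 : E) 1 ∩ K) :=
    (isCompact_sphere 0 1).inter_right K.closed_of_finiteDimensional
  obtain ⟨r, hr, hsphere⟩ : ∃ r > 0, ∀ x ∈ Metric.sphere (0 : E) 1 ∩ K,
      inner ℝ x (T x) ≤ -r := by
    rcases (Metric.sphere (0 : E) 1 ∩ K).eq_empty_or_nonempty with hempty | hne
    · exact ⟨1, one_pos, by
        simp only [hempty, Set.mem_empty_iff_false, false_implies, implies_true]⟩
    · obtain ⟨y, hy, hmax⟩ := hcompact.exists_isMaxOn hne hcont
      exact ⟨-inner ℝ y (T y), neg_pos.2 (hT y hy.2 (ne_zero_of_mem_unit_sphere ⟨y, hy.1⟩)),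
        fun x hx => (hmax hx).trans_eq (neg_neg _).symm⟩
  refine ⟨r, hr, fun x hx => ?_⟩
  rcases eq_or_ne x 0 with rfl | hx0
  · simp only [map_zero, inner_zero_left, norm_zero]; norm_num
  have hunit : ‖x‖⁻¹ • x ∈ Metric.sphere (0 : E) 1 ∩ K :=
    ⟨mem_sphere_zero_iff_norm.2 (norm_smul_inv_norm (𝕜 := ℝ) hx0), K.smul_mem _ hx⟩
  calc inner ℝ x (T x)
      = ‖x‖ ^ 2 * inner ℝ (‖x‖⁻¹ • x) (T (‖x‖⁻¹ • x)) := by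
        rw [map_smul, real_inner_smul_left, real_inner_smul_right]
        field_simp [norm_ne_zero_iff.2 hx0]
    _ ≤ ‖x‖ ^ 2 * -r := by gcongr; exact hsphere _ hunit
    _ = -r * ‖x‖ ^ 2 := mul_comm _ _

variable {ι : Type*} [Fintype ι] {H : Matrix ι ι ℝ}

theorem sum_mul_sub_sq_eq_neg_two_mul_dotProduct_mulVec (hrow : H *ᵥ (fun _ => 1) = 0)
    (hcol : (fun _ => 1) ᵥ* H = 0) (x : ι → ℝ) :
    ∑ i, ∑ j, H i j * (x i - x j) ^ 2 = -2 * (x ⬝ᵥ H *ᵥ x) := by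
  have hrow_sum : ∀ i, ∑ j, H i j = 0 := fun i => by
    simpa only [Matrix.mulVec, dotProduct, mul_one, Pi.zero_apply] using congrFun hrow i
  have hcol_sum : ∀ j, ∑ i, H i j = 0 := fun j => by
    simpa only [Matrix.vecMul, dotProduct, one_mul, Pi.zero_apply] using congrFun hcol j
  have hrow_sq : ∑ i, ∑ j, H i j * x i ^ 2 = 0 := by
    simp only [← Finset.sum_mul, hrow_sum, zero_mul, Finset.sum_const_zero]
  have hcol_sq : ∑ i, ∑ j, H i j * x j ^ 2 = 0 := by
    rw [Finset.sum_comm]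
    simp only [← Finset.sum_mul, hcol_sum, zero_mul, Finset.sum_const_zero]
  calc ∑ i, ∑ j, H i j * (x i - x j) ^ 2
      = ∑ i, ∑ j, (H i j * x i ^ 2 + H i j * x j ^ 2 + -2 * (x i * (H i j * x j))) := by
        refine Finset.sum_congr rfl fun i _ => Finset.sum_congr rfl fun j _ => ?_
        ring
    _ = -2 * (x ⬝ᵥ H *ᵥ x) := by
        simp only [Finset.sum_add_distrib, hrow_sq, hcol_sq, zero_add, Matrix.mulVec, dotProduct,
          Finset.mul_sum]

theorem dotProduct_mulVec_neg_of_offDiag_nonneg (hoff : ∀ i j, i ≠ j → 0 ≤ H i j)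
    (hrow : H *ᵥ (fun _ => 1) = 0) (hcol : (fun _ => 1) ᵥ* H = 0)
    (hker : ∀ v, H *ᵥ v = 0 → ∃ c : ℝ, v = fun _ => c) {x : ι → ℝ} (hx : ∑ i, x i = 0)
    (hx0 : x ≠ 0) : x ⬝ᵥ H *ᵥ x < 0 := by
  have hterm : ∀ i j, 0 ≤ H i j * (x i - x j) ^ 2 := fun i j => by
    rcases eq_or_ne i j with rfl | hij
    · simp only [sub_self]; norm_num
    · exact mul_nonneg (hoff i j hij) (sq_nonneg _)
  have hform := sum_mul_sub_sq_eq_neg_two_mul_dotProduct_mulVec hrow hcol x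
  have hform_nonneg : 0 ≤ ∑ i, ∑ j, H i j * (x i - x j) ^ 2 :=
    Finset.sum_nonneg fun i _ => Finset.sum_nonneg fun j _ => hterm i j
  by_contra! hnonneg
  have hzero : ∀ i j, H i j * x j = H i j * x i := fun i j => by
    have hsum : ∑ i, ∑ j, H i j * (x i - x j) ^ 2 = 0 := by linarith
    have hsum_i := (Finset.sum_eq_zero_iff_of_nonneg fun i _ =>
      Finset.sum_nonneg fun j _ => hterm i j).1 hsum i (Finset.mem_univ i)
    rcases mul_eq_zero.1 ((Finset.sum_eq_zero_iff_of_nonneg fun j _ => hterm i j).1 hsum_i j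
      (Finset.mem_univ j)) with h | h
    · rw [h, zero_mul, zero_mul]
    · rw [sub_eq_zero.1 (pow_eq_zero_iff two_ne_zero |>.1 h)]
  have hmul : H *ᵥ x = 0 := by
    ext i
    have hi := congrFun hrow i
    simp only [Matrix.mulVec, dotProduct, mul_one, Pi.zero_apply] at hi ⊢
    rw [Finset.sum_congr rfl fun j _ => hzero i j, ← Finset.sum_mul, hi, zero_mul]
  obtain ⟨c, rfl⟩ := hker x hmul
  obtain ⟨i, hi⟩ := Function.ne_iff.1 hx0
  have : Nonempty ι := ⟨i⟩
  rw [Finset.sum_const, nsmul_eq_mul, mul_eq_zero, Nat.cast_eq_zero, Finset.card_eq_zero] at hx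
  exact hi (hx.resolve_left Finset.univ_nonempty.ne_empty)

theorem exists_inner_toEuclideanCLM_le_neg_mul_norm_sq [DecidableEq ι]
    (hoff : ∀ i j, i ≠ j → 0 ≤ H i j) (hrow : H *ᵥ (fun _ => 1) = 0)
    (hcol : (fun _ => 1) ᵥ* H = 0) (hker : ∀ v, H *ᵥ v = 0 → ∃ c : ℝ, v = fun _ => c) :
    ∃ r > 0, ∀ x : EuclideanSpace ℝ ι, ∑ i, x i = 0 →
      inner ℝ x (Matrix.toEuclideanCLM (𝕜 := ℝ) H x) ≤ -r * ‖x‖ ^ 2 := by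
  let sum : EuclideanSpace ℝ ι →ₗ[ℝ] ℝ := ∑ i, EuclideanSpace.projₗ i
  have hsum : ∀ x, x ∈ LinearMap.ker sum ↔ ∑ i, x i = 0 := fun x => by
    rw [LinearMap.mem_ker, LinearMap.sum_apply]; rfl
  obtain ⟨r, hr, hle⟩ := exists_inner_apply_le_neg_mul_norm_sq
    (Matrix.toEuclideanCLM (𝕜 := ℝ) H) (LinearMap.ker sum) fun x hx hx0 => by
      have hneg := dotProduct_mulVec_neg_of_offDiag_nonneg hoff hrow hcol hker ((hsum x).1 hx)
        fun h => hx0 (WithLp.ofLp_injective 2 h)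
      rw [dotProduct_comm] at hneg
      exact hneg
  exact ⟨r, hr, fun x hx => hle x ((hsum x).2 hx)⟩

end QuadraticForm

section FrobeniusNorm

variable {k l : ℕ}

theorem frobeniusNorm_nonneg (Z : Matrix (Fin k) (Fin l) ℝ) : 0 ≤ frobeniusNorm Z :=
  Real.sqrt_nonneg _

theorem frobeniusNorm_sq (Z : Matrix (Fin k) (Fin l) ℝ) :
    frobeniusNorm Z ^ 2 = ∑ i, ∑ j, Z i j ^ 2 :=
  Real.sq_sqrt (Finset.sum_nonneg fun _ _ => Finset.sum_nonneg fun _ _ => sq_nonneg _)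

theorem frobeniusNorm_le_of_abs_le {Z : Matrix (Fin k) (Fin l) ℝ} {K : ℝ} (hK : 0 ≤ K)
    (hZ : ∀ i j, |Z i j| ≤ K) : frobeniusNorm Z ≤ √(k * l) * K := by
  refine Real.sqrt_le_iff.2 ⟨by positivity, ?_⟩
  calc ∑ i, ∑ j, Z i j ^ 2 ≤ ∑ _i : Fin k, ∑ _j : Fin l, K ^ 2 :=
        Finset.sum_le_sum fun i _ => Finset.sum_le_sum fun j _ =>
          sq_le_sq.2 ((hZ i j).trans (le_abs_self K))
    _ = (√(k * l) * K) ^ 2 := by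
        rw [mul_pow, Real.sq_sqrt (by positivity)]
        simp only [Finset.sum_const, Finset.card_univ, Fintype.card_fin, nsmul_eq_mul, mul_assoc]

theorem norm_toEuclideanCLM_le_frobeniusNorm (A : Matrix (Fin k) (Fin k) ℝ) :
    ‖Matrix.toEuclideanCLM (𝕜 := ℝ) A‖ ≤ frobeniusNorm A := by
  refine ContinuousLinearMap.opNorm_le_bound _ (frobeniusNorm_nonneg A) fun x => ?_
  refine le_of_sq_le_sq ?_ (mul_nonneg (frobeniusNorm_nonneg A) (norm_nonneg x))
  rw [mul_pow, frobeniusNorm_sq, EuclideanSpace.real_norm_sq_eq, EuclideanSpace.real_norm_sq_eq,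
    Finset.sum_mul]
  exact Finset.sum_le_sum fun i _ => Finset.sum_mul_sq_le_sq_mul_sq Finset.univ (A i) x

theorem frobeniusNorm_isBigO {Z : ℕ → Matrix (Fin k) (Fin l) ℝ} {δ : ℕ → ℝ}
    (hZ : ∀ i j, (fun t => Z t i j) =O[atTop] δ) :
    (fun t => frobeniusNorm (Z t)) =O[atTop] δ := by
  refine IsBigO.of_pow two_ne_zero ?_
  simp only [Pi.pow_def, frobeniusNorm_sq]
  exact IsBigO.fun_sum fun i _ => IsBigO.fun_sum fun j _ => (hZ i j).pow 2

theorem stronglyMeasurable_frobeniusNorm {Ω : Type*} {m : MeasurableSpace Ω}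
    {Z : Ω → Matrix (Fin k) (Fin l) ℝ} (hZ : ∀ i j, StronglyMeasurable[m] fun ω => Z ω i j) :
    StronglyMeasurable[m] fun ω => frobeniusNorm (Z ω) :=
  Real.continuous_sqrt.comp_stronglyMeasurable <|
    Finset.stronglyMeasurable_fun_sum _ fun i _ =>
      Finset.stronglyMeasurable_fun_sum _ fun j _ => (hZ i j).pow 2

/-- The `m`-th column of a matrix, as a vector of Euclidean space: the opinion `m` is tracked
through this column of the estimates. -/
def colVec (Z : Matrix (Fin k) (Fin l) ℝ) (m : Fin l) : EuclideanSpace ℝ (Fin k) :=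
  WithLp.toLp 2 (Z.col m)

theorem colVec_apply (Z : Matrix (Fin k) (Fin l) ℝ) (m : Fin l) (i : Fin k) :
    colVec Z m i = Z i m :=
  rfl

theorem colVec_add (Z Z' : Matrix (Fin k) (Fin l) ℝ) (m : Fin l) :
    colVec (Z + Z') m = colVec Z m + colVec Z' m :=
  rfl

theorem colVec_sub (Z Z' : Matrix (Fin k) (Fin l) ℝ) (m : Fin l) :
    colVec (Z - Z') m = colVec Z m - colVec Z' m :=
  rfl

theorem colVec_smul (s : ℝ) (Z : Matrix (Fin k) (Fin l) ℝ) (m : Fin l) :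
    colVec (s • Z) m = s • colVec Z m :=
  rfl

theorem colVec_mul (A : Matrix (Fin k) (Fin k) ℝ) (Z : Matrix (Fin k) (Fin l) ℝ) (m : Fin l) :
    colVec (A * Z) m = Matrix.toEuclideanCLM (𝕜 := ℝ) A (colVec Z m) :=
  rfl

theorem norm_colVec_mul_le (A : Matrix (Fin k) (Fin k) ℝ) (Z : Matrix (Fin k) (Fin l) ℝ)
    (m : Fin l) : ‖colVec (A * Z) m‖ ≤ frobeniusNorm A * ‖colVec Z m‖ := by
  rw [colVec_mul]
  exact ContinuousLinearMap.le_of_opNorm_le _ (norm_toEuclideanCLM_le_frobeniusNorm A) _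

theorem norm_colVec_le_frobeniusNorm (Z : Matrix (Fin k) (Fin l) ℝ) (m : Fin l) :
    ‖colVec Z m‖ ≤ frobeniusNorm Z := by
  refine le_of_sq_le_sq ?_ (frobeniusNorm_nonneg Z)
  rw [frobeniusNorm_sq, EuclideanSpace.real_norm_sq_eq]
  exact Finset.sum_le_sum fun i _ =>
    Finset.single_le_sum (f := fun j => Z i j ^ 2) (fun j _ => sq_nonneg _) (Finset.mem_univ m)

theorem norm_colVec_le_sqrt_of_abs_le_one {Z : Matrix (Fin k) (Fin l) ℝ} {m : Fin l}
    (hZ : ∀ i, |Z i m| ≤ 1) : ‖colVec Z m‖ ≤ √k := by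
  refine Real.le_sqrt_of_sq_le ?_
  rw [EuclideanSpace.real_norm_sq_eq]
  calc ∑ i, Z i m ^ 2 ≤ ∑ _i : Fin k, (1 : ℝ) :=
        Finset.sum_le_sum fun i _ => (sq_le_one_iff_abs_le_one _).2 (hZ i)
    _ = k := by rw [Finset.sum_const, Finset.card_univ, Fintype.card_fin, nsmul_eq_mul, mul_one]

theorem stronglyMeasurable_colVec {Ω : Type*} {F : MeasurableSpace Ω}
    {Z : Ω → Matrix (Fin k) (Fin l) ℝ} {m : Fin l}
    (hZ : ∀ i, StronglyMeasurable[F] fun ω => Z ω i m) :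
    StronglyMeasurable[F] fun ω => colVec (Z ω) m :=
  ((WithLp.measurable_toLp 2 (Fin k → ℝ)).comp
    (measurable_pi_lambda _ fun i => (hZ i).measurable)).stronglyMeasurable

end FrobeniusNorm

section CondExpMatrix

variable {Ω : Type*} {F m0 : MeasurableSpace Ω} {μ : Measure Ω} {j k l : ℕ}

/-- A random matrix is essentially bounded if each of its entries is. -/
def EssBounded (μ : Measure Ω) (Z : Ω → Matrix (Fin k) (Fin l) ℝ) : Prop :=
  ∀ i j, MemLp (fun ω => Z ω i j) ⊤ μ

namespace EssBounded

variable {Z Z' : Ω → Matrix (Fin k) (Fin l) ℝ}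

theorem of_abs_le (hZm : ∀ i j, Measurable fun ω => Z ω i j) {K : ℝ}
    (hZ : ∀ᵐ ω ∂μ, ∀ i j, |Z ω i j| ≤ K) : EssBounded μ Z := fun i j =>
  memLp_top_of_bound (hZm i j).aestronglyMeasurable K (hZ.mono fun _ hω => hω i j)

theorem add (hZ : EssBounded μ Z) (hZ' : EssBounded μ Z') :
    EssBounded μ fun ω => Z ω + Z' ω := fun i j => (hZ i j).add (hZ' i j)

theorem sub (hZ : EssBounded μ Z) (hZ' : EssBounded μ Z') :
    EssBounded μ fun ω => Z ω - Z' ω := fun i j => (hZ i j).sub (hZ' i j)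

theorem smul (s : ℝ) (hZ : EssBounded μ Z) : EssBounded μ fun ω => s • Z ω := fun i j =>
  (hZ i j).const_smul s

theorem mul {A : Ω → Matrix (Fin j) (Fin k) ℝ} (hA : EssBounded μ A) (hZ : EssBounded μ Z) :
    EssBounded μ fun ω => A ω * Z ω := fun i m => by
  simp only [Matrix.mul_apply]
  exact memLp_finsetSum _ fun s _ => (hZ s m).mul (hA i s)

theorem condExp (hZ : EssBounded μ Z) : EssBounded μ (condExpMatrix μ F Z) := fun i j =>
  (hZ i j).condExp le_top

theorem integrable [IsFiniteMeasure μ] (hZ : EssBounded μ Z) (i : Fin k) (j : Fin l) :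
    Integrable (fun ω => Z ω i j) μ :=
  (hZ i j).integrable le_top

theorem memLp_colVec [IsFiniteMeasure μ] (hZ : EssBounded μ Z) (m : Fin l) :
    MemLp (fun ω => colVec (Z ω) m) 2 μ :=
  MemLp.of_eval_piLp fun i => (hZ i m).mono_exponent le_top

end EssBounded

theorem ae_eq_of_entries {Z Z' : Ω → Matrix (Fin k) (Fin l) ℝ}
    (h : ∀ i j, (fun ω => Z ω i j) =ᵐ[μ] fun ω => Z' ω i j) : Z =ᵐ[μ] Z' := by
  filter_upwards [ae_all_iff.2 fun i => ae_all_iff.2 (h i)] with ω hω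
  exact Matrix.ext hω

variable [IsFiniteMeasure μ] {Z Z' : Ω → Matrix (Fin k) (Fin l) ℝ}
  {A : Ω → Matrix (Fin j) (Fin k) ℝ}

theorem condExpMatrix_add (hZ : EssBounded μ Z) (hZ' : EssBounded μ Z') :
    condExpMatrix μ F (fun ω => Z ω + Z' ω) =ᵐ[μ]
      fun ω => condExpMatrix μ F Z ω + condExpMatrix μ F Z' ω :=
  ae_eq_of_entries fun i j => condExp_add (hZ.integrable i j) (hZ'.integrable i j) F

theorem condExpMatrix_sub (hZ : EssBounded μ Z) (hZ' : EssBounded μ Z') :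
    condExpMatrix μ F (fun ω => Z ω - Z' ω) =ᵐ[μ]
      fun ω => condExpMatrix μ F Z ω - condExpMatrix μ F Z' ω :=
  ae_eq_of_entries fun i j => condExp_sub (hZ.integrable i j) (hZ'.integrable i j) F

theorem condExp_mul_apply (hA : EssBounded μ A) (hZ : EssBounded μ Z) (i : Fin j) (m : Fin l) :
    μ[fun ω => (A ω * Z ω) i m | F] =ᵐ[μ]
      fun ω => ∑ s, (μ[(fun ω => A ω i s) * fun ω => Z ω s m | F]) ω := by
  have hint : ∀ s, Integrable ((fun ω => A ω i s) * fun ω => Z ω s m) μ := fun s =>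
    ((hZ s m).mul (hA i s)).integrable le_top
  have hentry : (fun ω => (A ω * Z ω) i m) = ∑ s, (fun ω => A ω i s) * fun ω => Z ω s m := by
    ext ω
    simp only [Matrix.mul_apply, Finset.sum_apply, Pi.mul_apply]
  filter_upwards [condExp_finsetSum (s := Finset.univ) (fun s _ => hint s) F] with ω hsum
  rw [hentry, hsum, Finset.sum_apply]

theorem condExpMatrix_mul_of_stronglyMeasurable_left
    (hAm : ∀ i s, StronglyMeasurable[F] fun ω => A ω i s) (hA : EssBounded μ A)
    (hZ : EssBounded μ Z) :
    condExpMatrix μ F (fun ω => A ω * Z ω) =ᵐ[μ] fun ω => A ω * condExpMatrix μ F Z ω :=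
  ae_eq_of_entries fun i m => by
    filter_upwards [condExp_mul_apply hA hZ i m, ae_all_iff.2 fun s =>
      condExp_mul_of_stronglyMeasurable_left (m := F) (hAm i s)
        (((hZ s m).mul (hA i s)).integrable le_top) (hZ.integrable s m)] with ω hsum hpull
    exact hsum.trans (Finset.sum_congr rfl fun s _ => hpull s)

theorem condExpMatrix_mul_of_stronglyMeasurable_right
    (hZm : ∀ s m, StronglyMeasurable[F] fun ω => Z ω s m) (hA : EssBounded μ A)
    (hZ : EssBounded μ Z) :
    condExpMatrix μ F (fun ω => A ω * Z ω) =ᵐ[μ] fun ω => condExpMatrix μ F A ω * Z ω :=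
  ae_eq_of_entries fun i m => by
    filter_upwards [condExp_mul_apply hA hZ i m, ae_all_iff.2 fun s =>
      condExp_mul_of_stronglyMeasurable_right (m := F) (hZm s m)
        (((hZ s m).mul (hA i s)).integrable le_top) (hA.integrable i s)] with ω hsum hpull
    exact hsum.trans (Finset.sum_congr rfl fun s _ => hpull s)

theorem condExp_colVec (hZ : EssBounded μ Z) (m : Fin l) :
    μ[fun ω => colVec (Z ω) m | F] =ᵐ[μ] fun ω => colVec (condExpMatrix μ F Z ω) m := by
  have hint : Integrable (fun ω => colVec (Z ω) m) μ := (hZ.memLp_colVec m).integrable one_le_two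
  have hcoord : ∀ i, (fun ω => (μ[fun ω => colVec (Z ω) m | F]) ω i) =ᵐ[μ]
      μ[fun ω => Z ω i m | F] := fun i =>
    (EuclideanSpace.proj (𝕜 := ℝ) i).comp_condExp_comm hint
  filter_upwards [ae_all_iff.2 hcoord] with ω hω
  exact PiLp.ext hω

end CondExpMatrix

namespace SocialSampling

variable {n M : ℕ} {Ω : Type*} [mΩ : MeasurableSpace Ω] {μ : Measure Ω}

/-- The increment of the estimates, so that `Q(t + 1) = Q(t) + δ(t) D(t)`. -/
noncomputable def increment (S : SocialSampling n M μ) (t : ℕ) (ω : Ω) :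
    Matrix (Fin n) (Fin M) ℝ :=
  (S.W t ω - S.B t ω) * S.Y t ω - S.A t ω * S.Q t ω

/-- The consensus `1 Π`: every row is the empirical distribution. -/
noncomputable def consensus (S : SocialSampling n M μ) (ω : Ω) : Matrix (Fin n) (Fin M) ℝ :=
  Matrix.of fun _ => S.empirical ω

/-- The distance vector of the opinion `m` from consensus: the `m`-th column of `Q(t) - 1 Π`. -/
noncomputable def deviation (S : SocialSampling n M μ) (m : Fin M) (t : ℕ) (ω : Ω) :
    EuclideanSpace ℝ (Fin n) :=
  colVec (S.Q t ω - S.consensus ω) m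

/-- The error made in replacing the mean dynamics of an opinion by `H`. The factor `1 + √n`
accounts for the bound `‖q‖ ≤ ‖z‖ + √n` of a column `q` of the estimates by its deviation `z`. -/
noncomputable def driftError (S : SocialSampling n M μ) (H : Matrix (Fin n) (Fin n) ℝ) (t : ℕ)
    (ω : Ω) : ℝ :=
  (1 + √n) * frobeniusNorm (S.Hbar t ω - H) + frobeniusNorm (condExpMatrix μ (S.F t) (S.C t) ω)

variable (S : SocialSampling n M μ)

theorem Q_succ (t : ℕ) (ω : Ω) : S.Q (t + 1) ω = S.Q t ω + S.δ t • S.increment t ω := by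
  rw [S.update, increment, A, B]
  simp only [Matrix.sub_mul, Matrix.one_mul, Matrix.smul_mul, smul_sub]
  abel

theorem deviation_succ (m : Fin M) (t : ℕ) :
    S.deviation m (t + 1) =
      S.deviation m t + S.δ t • fun ω => colVec (S.increment t ω) m := by
  ext1 ω
  rw [deviation, Q_succ, add_sub_right_comm, colVec_add, colVec_smul]
  rfl

theorem measurable_A (t : ℕ) (i j : Fin n) : Measurable fun ω => S.A t ω i j := by
  simp only [A, Matrix.diagonal_apply]
  split_ifs
  · exact S.measurable_a t i
  · exact measurable_const

theorem measurable_B (t : ℕ) (i j : Fin n) : Measurable fun ω => S.B t ω i j := by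
  simp only [B, Matrix.diagonal_apply]
  split_ifs
  · exact S.measurable_b t i
  · exact measurable_const

theorem measurable_Q (t : ℕ) : ∀ i m, Measurable fun ω => S.Q t ω i m := by
  induction t with
  | zero =>
    intro i m
    simp only [S.init]
    exact (measurable_of_finite fun x : Fin M => (Pi.single x (1 : ℝ) : Fin M → ℝ) m).comp
      (S.measurable_X i)
  | succ t ih =>
    intro i m
    simp only [Q_succ, increment, Matrix.add_apply, Matrix.smul_apply, Matrix.sub_apply,
      Matrix.mul_apply, smul_eq_mul]
    refine (ih i m).add (measurable_const.mul (Measurable.sub ?_ ?_))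
    · exact Finset.measurable_fun_sum _ fun j _ =>
        ((S.measurable_W t i j).sub (S.measurable_B t i j)).mul (S.measurable_Y t j m)
    · exact Finset.measurable_fun_sum _ fun j _ => (S.measurable_A t i j).mul (ih j m)

theorem F_le (t : ℕ) : S.F t ≤ mΩ := by
  refine sup_le (iSup₂_le fun s _ => iSup₂_le fun i m => ?_)
    (MeasurableSpace.generateFrom_le ?_)
  · rw [← (inferInstance : BorelSpace ℝ).measurable_eq]
    exact (S.measurable_Q s i m).comap_le
  · rintro E ⟨s, _, i, j, rfl⟩
    exact S.measurableSet_G s i j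

theorem F_mono : Monotone S.F := by
  intro t u htu
  refine sup_le_sup (iSup_mono fun s => iSup_le fun hs => le_iSup_of_le (hs.trans htu) le_rfl)
    (MeasurableSpace.generateFrom_mono ?_)
  rintro E ⟨s, hs, h⟩
  exact ⟨s, hs.trans_le htu, h⟩

/-- The filtration of the histories `F_t`. -/
def filtration : Filtration ℕ mΩ where
  seq := S.F
  mono' := S.F_mono
  le' := S.F_le

theorem measurable_F_Q (t : ℕ) (i : Fin n) (m : Fin M) :
    Measurable[S.F t] fun ω => S.Q t ω i m := by
  refine measurable_iff_comap_le.2 ?_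
  rw [(inferInstance : BorelSpace ℝ).measurable_eq]
  refine le_trans ?_ le_sup_left
  exact le_iSup_of_le t (le_iSup_of_le le_rfl (le_iSup_of_le i (le_iSup_of_le m le_rfl)))

theorem stronglyMeasurable_Q (t : ℕ) (i : Fin n) (m : Fin M) :
    StronglyMeasurable[S.F t] fun ω => S.Q t ω i m :=
  (S.measurable_F_Q t i m).stronglyMeasurable

theorem stronglyMeasurable_P (t : ℕ) (i : Fin n) (m : Fin M) :
    StronglyMeasurable[S.F t] fun ω => S.P t ω i m := by
  have hrow : Measurable[S.F t] fun ω => S.Q t ω i :=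
    @measurable_pi_lambda _ _ _ (S.F t) _ _ fun m => S.measurable_F_Q t i m
  exact (((measurable_pi_apply m).comp (S.measurable_rule t i)).comp hrow).stronglyMeasurable

theorem stronglyMeasurable_Hbar (t : ℕ) (i j : Fin n) :
    StronglyMeasurable[S.F t] fun ω => S.Hbar t ω i j :=
  (stronglyMeasurable_condExp.sub stronglyMeasurable_condExp).sub stronglyMeasurable_condExp

theorem empirical_eq_mean_Q_zero (ω : Ω) (m : Fin M) :
    S.empirical ω m = (1 / (n : ℝ)) * ∑ i, S.Q 0 ω i m := by
  simp only [empirical, S.init, Pi.single_apply, eq_comm]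

theorem stronglyMeasurable_empirical (t : ℕ) (m : Fin M) :
    StronglyMeasurable[S.F t] fun ω => S.empirical ω m := by
  simp only [empirical_eq_mean_Q_zero]
  exact (Finset.stronglyMeasurable_fun_sum _ fun i _ =>
    (S.stronglyMeasurable_Q 0 i m).mono (S.F_mono t.zero_le)).const_mul _

theorem stronglyMeasurable_deviation (m : Fin M) (t : ℕ) :
    StronglyMeasurable[S.F t] (S.deviation m t) :=
  stronglyMeasurable_colVec fun i =>
    (S.stronglyMeasurable_Q t i m).sub (S.stronglyMeasurable_empirical t m)

theorem abs_empirical_le_one (ω : Ω) (m : Fin M) : |S.empirical ω m| ≤ 1 := by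
  have hnonneg : 0 ≤ ∑ i, if S.X i ω = m then (1 : ℝ) else 0 :=
    Finset.sum_nonneg fun i _ => by split_ifs <;> norm_num
  have hle : ∑ i, (if S.X i ω = m then (1 : ℝ) else 0) ≤ n := by
    rw [Finset.sum_boole]
    exact_mod_cast (Finset.card_filter_le _ _).trans_eq (Finset.card_fin n)
  rw [empirical, abs_of_nonneg (mul_nonneg (by positivity) hnonneg), one_div_mul_eq_div]
  exact div_le_one_of_le₀ hle (Nat.cast_nonneg n)

theorem norm_colVec_Q_le (m : Fin M) (t : ℕ) (ω : Ω) :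
    ‖colVec (S.Q t ω) m‖ ≤ ‖S.deviation m t ω‖ + √n := by
  have hconsensus : ‖colVec (S.consensus ω) m‖ ≤ √n :=
    norm_colVec_le_sqrt_of_abs_le_one fun _ => S.abs_empirical_le_one ω m
  rw [← sub_add_cancel (S.Q t ω) (S.consensus ω), colVec_add]
  exact (norm_add_le _ _).trans (add_le_add_right hconsensus _)

theorem mul_consensus_eq_zero {H : Matrix (Fin n) (Fin n) ℝ} (hrow : H *ᵥ (fun _ => 1) = 0)
    (ω : Ω) : H * S.consensus ω = 0 := by
  ext i m
  have hi := congrFun hrow i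
  simp only [Matrix.mulVec, dotProduct, mul_one, Pi.zero_apply] at hi
  simp only [consensus, Matrix.mul_apply, Matrix.of_apply, ← Finset.sum_mul, hi, zero_mul,
    Matrix.zero_apply]

theorem toEuclideanCLM_colVec_Q {H : Matrix (Fin n) (Fin n) ℝ}
    (hrow : H *ᵥ (fun _ => 1) = 0) (m : Fin M) (t : ℕ) (ω : Ω) :
    Matrix.toEuclideanCLM (𝕜 := ℝ) H (colVec (S.Q t ω) m) =
      Matrix.toEuclideanCLM (𝕜 := ℝ) H (S.deviation m t ω) := by
  rw [deviation, ← colVec_mul, ← colVec_mul, Matrix.mul_sub, S.mul_consensus_eq_zero hrow,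
    sub_zero]

theorem Y_eq_indicator (t : ℕ) (i : Fin n) (m : Fin M) :
    (fun ω => S.Y t ω i m) =
      Set.indicator {ω | S.Y t ω i = Pi.single m 1} (fun _ => (1 : ℝ)) := by
  have hmem : ∀ {v : Fin M → ℝ}, v ∈ messageSet M →
      v m = if v = Pi.single m 1 then 1 else 0 := by
    rintro v (hv | ⟨k, hv⟩)
    · obtain rfl : v = 0 := hv
      rw [if_neg (Pi.single_ne_zero_iff.2 one_ne_zero).symm, Pi.zero_apply]
    · obtain rfl : v = Pi.single k 1 := hv.symm
      rcases eq_or_ne k m with rfl | hkm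
      · rw [if_pos rfl, Pi.single_eq_same]
      · have hne : (Pi.single k 1 : Fin M → ℝ) ≠ Pi.single m 1 := fun heq => by
          simpa only [Pi.single_eq_of_ne hkm.symm, Pi.single_eq_same, zero_ne_one]
            using congrFun heq m
        rw [if_neg hne, Pi.single_eq_of_ne hkm.symm]
  ext ω
  classical
  rw [hmem (S.Y_mem t ω i), Set.indicator_apply]
  rfl

theorem condExp_Y (t : ℕ) (i : Fin n) (m : Fin M) :
    μ[fun ω => S.Y t ω i m | S.F t] =ᵐ[μ] fun ω => S.P t ω i m := by
  rw [S.Y_eq_indicator]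
  exact S.sampling t i m

theorem abs_Y_le_one (t : ℕ) (ω : Ω) (i : Fin n) (m : Fin M) : |S.Y t ω i m| ≤ 1 := by
  rw [congrFun (S.Y_eq_indicator t i m) ω, Set.indicator_apply]
  split_ifs <;> norm_num

theorem essBounded_Y (t : ℕ) : EssBounded μ (S.Y t) :=
  .of_abs_le (S.measurable_Y t) (ae_of_all _ (S.abs_Y_le_one t))

theorem essBounded_P (t : ℕ) : EssBounded μ (S.P t) := fun i m =>
  ((S.essBounded_Y t i m).condExp le_top).ae_eq (S.condExp_Y t i m)

theorem essBounded_consensus : EssBounded μ S.consensus :=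
  .of_abs_le (fun _ m => ((S.stronglyMeasurable_empirical 0 m).mono (S.F_le 0)).measurable)
    (ae_of_all _ fun ω _ m => S.abs_empirical_le_one ω m)

theorem increment_eq (t : ℕ) (ω : Ω) :
    S.increment t ω = S.C t ω + (S.Wbar t ω - S.Bbar t ω) * S.Y t ω
      - ((S.W t ω - S.B t ω) * (S.P t ω - S.Q t ω) + S.A t ω * S.Q t ω) := by
  simp only [increment, C, Matrix.add_mul, Matrix.sub_mul]
  abel

variable {S}

theorem BoundedCoefficients.exists_abs_le (h : S.BoundedCoefficients) :
    ∃ K, 0 ≤ K ∧ ∀ t, ∀ᵐ ω ∂μ, ∀ i j,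
      |S.W t ω i j| ≤ K ∧ |S.A t ω i j| ≤ K ∧ |S.B t ω i j| ≤ K := by
  obtain ⟨K, hK⟩ := h
  have hdiagonal : ∀ {v : Fin n → ℝ}, (∀ i, |v i| ≤ K) →
      ∀ i j, |Matrix.diagonal v i j| ≤ |K| := fun {v} hv i j => by
    rw [Matrix.diagonal_apply]
    split_ifs
    · exact (hv i).trans (le_abs_self K)
    · exact abs_zero.trans_le (abs_nonneg K)
  refine ⟨|K|, abs_nonneg K, fun t => ?_⟩
  filter_upwards [hK t] with ω hω i j
  exact ⟨(hω.1 i j).trans (le_abs_self K), hdiagonal (fun i => (hω.2 i).1) i j,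
    hdiagonal (fun i => (hω.2 i).2) i j⟩

theorem BoundedCoefficients.essBounded_W (h : S.BoundedCoefficients) (t : ℕ) :
    EssBounded μ (S.W t) := by
  obtain ⟨K, -, hK⟩ := h.exists_abs_le
  exact .of_abs_le (S.measurable_W t) ((hK t).mono fun ω hω i j => (hω i j).1)

theorem BoundedCoefficients.essBounded_A (h : S.BoundedCoefficients) (t : ℕ) :
    EssBounded μ (S.A t) := by
  obtain ⟨K, -, hK⟩ := h.exists_abs_le
  exact .of_abs_le (S.measurable_A t) ((hK t).mono fun ω hω i j => (hω i j).2.1)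

theorem BoundedCoefficients.essBounded_B (h : S.BoundedCoefficients) (t : ℕ) :
    EssBounded μ (S.B t) := by
  obtain ⟨K, -, hK⟩ := h.exists_abs_le
  exact .of_abs_le (S.measurable_B t) ((hK t).mono fun ω hω i j => (hω i j).2.2)

theorem BoundedCoefficients.essBounded_Q (h : S.BoundedCoefficients) (t : ℕ) :
    EssBounded μ (S.Q t) := by
  induction t with
  | zero =>
    refine .of_abs_le (S.measurable_Q 0) (K := 1) (ae_of_all _ fun ω i m => ?_)
    rw [S.init, Pi.single_apply]
    split_ifs <;> norm_num
  | succ t ih =>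
    rw [funext (S.Q_succ t)]
    exact ih.add (.smul _ ((((h.essBounded_W t).sub (h.essBounded_B t)).mul
      (S.essBounded_Y t)).sub ((h.essBounded_A t).mul ih)))

theorem BoundedCoefficients.exists_norm_colVec_increment_le (h : S.BoundedCoefficients) :
    ∃ K, ∀ m t, ∀ᵐ ω ∂μ,
      ‖colVec (S.increment t ω) m‖ ≤ K * (1 + ‖S.deviation m t ω‖) := by
  obtain ⟨K, hK0, hK⟩ := h.exists_abs_le
  let L := √(n * n) * (2 * K)
  have hL : 0 ≤ L := by positivity
  refine ⟨L * (1 + 2 * √n), fun m t => ?_⟩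
  filter_upwards [hK t] with ω hω
  have hWB : frobeniusNorm (S.W t ω - S.B t ω) ≤ L :=
    frobeniusNorm_le_of_abs_le (by positivity) fun i j =>
      (abs_sub _ _).trans (by linarith [(hω i j).1, (hω i j).2.2])
  have hA : frobeniusNorm (S.A t ω) ≤ L :=
    frobeniusNorm_le_of_abs_le (by positivity) fun i j => by linarith [(hω i j).2.1]
  have hY : ‖colVec (S.Y t ω) m‖ ≤ √n :=
    norm_colVec_le_sqrt_of_abs_le_one fun i => S.abs_Y_le_one t ω i m
  have hsqrt : 0 ≤ L * (2 * √n) * ‖S.deviation m t ω‖ := by positivity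
  rw [increment, colVec_sub]
  calc ‖colVec ((S.W t ω - S.B t ω) * S.Y t ω) m - colVec (S.A t ω * S.Q t ω) m‖
      ≤ frobeniusNorm (S.W t ω - S.B t ω) * ‖colVec (S.Y t ω) m‖
          + frobeniusNorm (S.A t ω) * ‖colVec (S.Q t ω) m‖ :=
        (norm_sub_le _ _).trans (add_le_add (norm_colVec_mul_le _ _ m) (norm_colVec_mul_le _ _ m))
    _ ≤ L * √n + L * (‖S.deviation m t ω‖ + √n) := by
        gcongr
        exact S.norm_colVec_Q_le m t ω
    _ ≤ L * (1 + 2 * √n) * (1 + ‖S.deviation m t ω‖) := by linarith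

theorem MeanPreservation.sum_deviation (h : S.MeanPreservation) (m : Fin M) (t : ℕ) :
    ∀ᵐ ω ∂μ, ∑ i, S.deviation m t ω i = 0 := by
  filter_upwards [h t] with ω hω
  simp only [deviation, colVec_apply, consensus, Matrix.sub_apply, Matrix.of_apply,
    Finset.sum_sub_distrib, Finset.sum_const, Finset.card_fin, nsmul_eq_mul, ← hω m]
  rcases Nat.eq_zero_or_pos n with rfl | hn
  · simp only [Finset.univ_eq_empty, Finset.sum_empty, Nat.cast_zero, zero_mul, sub_zero]
  · rw [sub_eq_zero]
    field_simp

theorem DecreasingStepSize.summable_sq (h : S.DecreasingStepSize) :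
    Summable fun t => S.δ t ^ 2 :=
  (summable_nat_add_iff 1).1 h.2.2.2

theorem DecreasingStepSize.not_summable (h : S.DecreasingStepSize) : ¬ Summable S.δ := by
  intro hsum
  refine not_tendsto_atTop_of_tendsto_nhds (a := ∑' t, S.δ (t + 1)) ?_ h.2.2.1
  refine (((summable_nat_add_iff 1).2 hsum).hasSum.tendsto_sum_nat).congr fun T => ?_
  rw [Finset.range_eq_Ico, Finset.sum_Ico_add' S.δ 0 T 1]
  rfl

theorem Hbar_nonneg_of_ne (S : SocialSampling n M μ) (t : ℕ) {i j : Fin n} (hij : i ≠ j) :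
    ∀ᵐ ω ∂μ, 0 ≤ S.Hbar t ω i j := by
  have hA : (fun ω => S.A t ω i j) = 0 := funext fun _ => Matrix.diagonal_apply_ne _ hij
  have hB : (fun ω => S.B t ω i j) = 0 := funext fun _ => Matrix.diagonal_apply_ne _ hij
  filter_upwards [condExp_nonneg (m := S.F t) (μ := μ)
    (ae_of_all _ fun ω => S.W_nonneg t ω i j)] with ω hω
  simpa only [Hbar, Wbar, Abar, Bbar, condExpMatrix, hA, hB, condExp_zero, Matrix.sub_apply,
    Matrix.of_apply, Pi.zero_apply, sub_zero] using hω

variable {H : Matrix (Fin n) (Fin n) ℝ}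

theorem offDiag_nonneg_of_isBigO [NeZero μ]
    (hδ : Tendsto S.δ atTop (𝓝 0))
    (hH : ∀ i j, ∀ᵐ ω ∂μ, (fun t => S.Hbar t ω i j - H i j) =O[atTop] S.δ)
    {i j : Fin n} (hij : i ≠ j) : 0 ≤ H i j := by
  obtain ⟨ω, hnonneg, hO⟩ :=
    ((ae_all_iff.2 fun t => S.Hbar_nonneg_of_ne t hij).and (hH i j)).exists
  have hlim : Tendsto (fun t => S.Hbar t ω i j) atTop (𝓝 (H i j)) :=
    tendsto_sub_nhds_zero_iff.1 (hO.trans_tendsto hδ)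
  exact ge_of_tendsto' hlim hnonneg

theorem driftError_nonneg (t : ℕ) (ω : Ω) : 0 ≤ S.driftError H t ω :=
  add_nonneg (mul_nonneg (by positivity) (frobeniusNorm_nonneg _)) (frobeniusNorm_nonneg _)

theorem stronglyMeasurable_driftError (t : ℕ) :
    StronglyMeasurable[S.F t] (S.driftError H t) :=
  ((stronglyMeasurable_frobeniusNorm fun i j =>
      (S.stronglyMeasurable_Hbar t i j).sub stronglyMeasurable_const).const_mul _).add
    (stronglyMeasurable_frobeniusNorm fun _ _ => stronglyMeasurable_condExp)

theorem BoundedPerturbation.driftError_isBigO (h : S.BoundedPerturbation)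
    (hH : ∀ i j, ∀ᵐ ω ∂μ, (fun t => S.Hbar t ω i j - H i j) =O[atTop] S.δ) :
    ∀ᵐ ω ∂μ, (fun t => S.driftError H t ω) =O[atTop] S.δ := by
  filter_upwards [h, ae_all_iff.2 fun i => ae_all_iff.2 (hH i)] with ω hCω hHω
  exact ((frobeniusNorm_isBigO hHω).const_mul_left _).add hCω

theorem BoundedCoefficients.essBounded_increment (h : S.BoundedCoefficients) (t : ℕ) :
    EssBounded μ (S.increment t) :=
  (((h.essBounded_W t).sub (h.essBounded_B t)).mul (S.essBounded_Y t)).sub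
    ((h.essBounded_A t).mul (h.essBounded_Q t))

theorem BoundedCoefficients.essBounded_C (h : S.BoundedCoefficients) (t : ℕ) :
    EssBounded μ (S.C t) :=
  (((h.essBounded_W t).sub (h.essBounded_B t)).mul ((S.essBounded_P t).sub (h.essBounded_Q t))).add
    (((((h.essBounded_W t).sub (h.essBounded_B t)).sub (h.essBounded_W t).condExp).add
      (h.essBounded_B t).condExp).mul (S.essBounded_Y t))

variable [IsFiniteMeasure μ]

theorem BoundedCoefficients.memLp_deviation (h : S.BoundedCoefficients) (m : Fin M) (t : ℕ) :
    MemLp (S.deviation m t) 2 μ :=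
  ((h.essBounded_Q t).sub S.essBounded_consensus).memLp_colVec m

theorem BoundedCoefficients.condExpMatrix_increment (h : S.BoundedCoefficients) (t : ℕ) :
    condExpMatrix μ (S.F t) (S.increment t) =ᵐ[μ] fun ω =>
      S.Hbar t ω * S.Q t ω + condExpMatrix μ (S.F t) (S.C t) ω := by
  have hWB := (h.essBounded_W t).sub (h.essBounded_B t)
  have hWBbar : EssBounded μ fun ω => S.Wbar t ω - S.Bbar t ω :=
    (h.essBounded_W t).condExp.sub (h.essBounded_B t).condExp
  have hPQ := (S.essBounded_P t).sub (h.essBounded_Q t)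
  have hWBbarY := hWBbar.mul (S.essBounded_Y t)
  have hWBPQ := hWB.mul hPQ
  have hAQ := (h.essBounded_A t).mul (h.essBounded_Q t)
  have hWBbar_meas : ∀ i j, StronglyMeasurable[S.F t] fun ω => (S.Wbar t ω - S.Bbar t ω) i j :=
    fun _ _ => stronglyMeasurable_condExp.sub stronglyMeasurable_condExp
  have hPQ_meas : ∀ i m, StronglyMeasurable[S.F t] fun ω => (S.P t ω - S.Q t ω) i m :=
    fun i m => (S.stronglyMeasurable_P t i m).sub (S.stronglyMeasurable_Q t i m)
  have hY : condExpMatrix μ (S.F t) (S.Y t) =ᵐ[μ] S.P t := ae_eq_of_entries (S.condExp_Y t)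
  rw [funext (S.increment_eq t)]
  filter_upwards [condExpMatrix_sub (F := S.F t) ((h.essBounded_C t).add hWBbarY) (hWBPQ.add hAQ),
    condExpMatrix_add (F := S.F t) (h.essBounded_C t) hWBbarY,
    condExpMatrix_add (F := S.F t) hWBPQ hAQ,
    condExpMatrix_mul_of_stronglyMeasurable_left hWBbar_meas hWBbar (S.essBounded_Y t),
    condExpMatrix_mul_of_stronglyMeasurable_right hPQ_meas hWB hPQ,
    condExpMatrix_mul_of_stronglyMeasurable_right (S.stronglyMeasurable_Q t) (h.essBounded_A t)
      (h.essBounded_Q t),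
    condExpMatrix_sub (F := S.F t) (h.essBounded_W t) (h.essBounded_B t), hY]
    with ω hsub haddC hadd hpullY hpullPQ hpullQ hWB hY
  rw [hsub, haddC, hadd, hpullY, hpullPQ, hpullQ, hWB, hY, Hbar, Wbar, Bbar, Abar]
  simp only [Matrix.sub_mul, Matrix.mul_sub]
  abel

theorem BoundedCoefficients.inner_deviation_condExp_increment_le (h : S.BoundedCoefficients)
    (hmean : S.MeanPreservation) (hrow : H *ᵥ (fun _ => 1) = 0) {r : ℝ}
    (hform : ∀ x : EuclideanSpace ℝ (Fin n), ∑ i, x i = 0 →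
      inner ℝ x (Matrix.toEuclideanCLM (𝕜 := ℝ) H x) ≤ -r * ‖x‖ ^ 2) (m : Fin M) (t : ℕ) :
    ∀ᵐ ω ∂μ, inner ℝ (S.deviation m t ω)
        ((μ[fun ω => colVec (S.increment t ω) m | S.F t]) ω) ≤
      -r * ‖S.deviation m t ω‖ ^ 2 + S.driftError H t ω * (1 + ‖S.deviation m t ω‖ ^ 2) := by
  filter_upwards [condExp_colVec (F := S.F t) (h.essBounded_increment t) m,
    h.condExpMatrix_increment t, hmean.sum_deviation m t] with ω hcol hincrement hsum
  have hdiff : ‖Matrix.toEuclideanCLM (𝕜 := ℝ) (S.Hbar t ω) - Matrix.toEuclideanCLM (𝕜 := ℝ) H‖ ≤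
      frobeniusNorm (S.Hbar t ω - H) := by
    rw [← map_sub]
    exact norm_toEuclideanCLM_le_frobeniusNorm _
  rw [hcol, hincrement, colVec_add, colVec_mul]
  exact inner_apply_add_le (hform _ hsum) (S.toEuclideanCLM_colVec_Q hrow m t ω)
    (Real.sqrt_nonneg _) (S.norm_colVec_Q_le m t ω) hdiff (norm_colVec_le_frobeniusNorm _ m)

end SocialSampling

theorem mainTheorem3_general {n M : ℕ} {Ω : Type*} [MeasurableSpace Ω] (μ : Measure Ω)
    [IsFiniteMeasure μ] (S : SocialSampling n M μ)
    (hbounded : S.BoundedCoefficients)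
    (hstep : S.DecreasingStepSize)
    (H : Matrix (Fin n) (Fin n) ℝ)
    (hH : ∀ i j, ∀ᵐ ω ∂μ, (fun t => S.Hbar t ω i j - H i j) =O[atTop] S.δ)
    (hrow : H *ᵥ (fun _ => 1) = 0)
    (hcol : (fun _ => 1) ᵥ* H = 0)
    (hker : ∀ v : Fin n → ℝ, H *ᵥ v = 0 → ∃ c : ℝ, v = fun _ => c)
    (hperturb : S.BoundedPerturbation)
    (hmean : S.MeanPreservation) :
    ∀ᵐ ω ∂μ, Tendsto (fun t => S.Q t ω) atTop
      (𝓝 (Matrix.of fun (_ : Fin n) => S.empirical ω)) := by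
  rcases eq_zero_or_neZero μ with rfl | _
  · rw [ae_zero]
    exact eventually_bot
  obtain ⟨r, hr, hform⟩ := exists_inner_toEuclideanCLM_le_neg_mul_norm_sq
    (fun i j => SocialSampling.offDiag_nonneg_of_isBigO hstep.2.1 hH) hrow hcol hker
  obtain ⟨K, hgrowth⟩ := hbounded.exists_norm_colVec_increment_le
  have hdeviation : ∀ m, ∀ᵐ ω ∂μ, Tendsto (fun t => S.deviation m t ω) atTop (𝓝 0) := fun m =>
    ae_tendsto_zero_of_inner_condExp_le (ℱ := S.filtration) hr hstep.1 hstep.not_summable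
      hstep.summable_sq (S.stronglyMeasurable_deviation m) (hbounded.memLp_deviation m)
      (fun t => (hbounded.essBounded_increment t).memLp_colVec m)
      (fun t => .of_eq (S.deviation_succ m t)) (hgrowth m)
      SocialSampling.stronglyMeasurable_driftError SocialSampling.driftError_nonneg
      (hperturb.driftError_isBigO hH)
      (hbounded.inner_deviation_condExp_increment_le hmean hrow hform m)
  filter_upwards [ae_all_iff.2 hdeviation] with ω hω
  refine tendsto_pi_nhds.2 fun i => tendsto_pi_nhds.2 fun m => ?_
  exact tendsto_sub_nhds_zero_iff.1 (((EuclideanSpace.proj (𝕜 := ℝ) i).continuous.tendsto' 0 0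
    (map_zero _)).comp (hω m))

theorem mainTheorem3 {n M : ℕ} {Ω : Type*} [MeasurableSpace Ω] (μ : Measure Ω)
    [IsProbabilityMeasure μ] (S : SocialSampling n M μ)
    (hbounded : S.BoundedCoefficients)
    (hmixing : S.MixingCoefficients)
    (hstep : S.DecreasingStepSize)
    (hlimit : S.LimitingDynamics)
    (hperturb : S.BoundedPerturbation)
    (hmean : S.MeanPreservation) :
    ∀ᵐ ω ∂μ, Tendsto (fun t => S.Q t ω) atTop
      (𝓝 (Matrix.of fun (_ : Fin n) => S.empirical ω)) := by
  obtain ⟨H, hsymm, hH, -, hrow, hker⟩ := hlimit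
  have hcol : (fun _ => 1) ᵥ* H = 0 := by rw [← Matrix.mulVec_transpose, hsymm.eq, hrow]
  exact mainTheorem3_general μ S hbounded hstep H hH hrow hcol hker hperturb hmean
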